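/- For $c=(c_1,c_2,c_3)\in\mathbb{R}^3$ consider the equation $$(1-x^2)U'+2xU+\tfrac12U^2=c_1(1-x)+c_2(1+x)+c_3(1-x^2),\qquad -1<x<1. \tag{$*$}$$ A solution of $(*)$ is a function $U\in C^1(-1,1)$ satisfying $(*)$ on $(-1,1)$. For $c_1,c_2\ge -1$ put $$\bar c_3(c_1,c_2)=-\tfrac12\left(\sqrt{1+c_1}+\sqrt{1+c_2}\right)\left(\sqrt{1+c_1}+\sqrt{1+c_2}+2\right),$$ and let $J=\{c\in\mathbb{R}^3 : c_1\ge-1,\ c_2\ge-1,\ c_3\ge\bar c_3(c_1,c_2)\}$. For every $c\in J$ equation $(*)$ has a greatest solution $U^+(c)$ and a least solution $U^-(c)$, i.e. solutions with $U^-(c)\le U\le U^+(c)$ on $(-1,1)$ for every solution $U$. Set $\gamma^\pm(c)=U^\pm(c)(0)$. Then: 1. $\gamma^+$ is $C^\infty$ on $J\setminus\{c : c_1=-1\}$, and $(c_2,c_3)\mapsto\gamma^+(-1,c_2,c_3)$ is $C^\infty$ on $\{(c_2,c_3) : (-1,c_2,c_3)\in J\}$. 2. $\gamma^-$ is $C^\infty$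 on $J\setminus\{c : c_2=-1\}$, and $(c_1,c_3)\mapsto\gamma^-(c_1,-1,c_3)$ is $C^\infty$ on $\{(c_1,c_3) : (c_1,-1,c_3)\in J\}$. Here $C^\infty$ on one of these (convex, not open) sets means smooth up to those boundary points that belong to the set. -/

import Mathlib

open scoped ContDiff

noncomputable section

namespace HomogNS

/-- The right-hand side `P_c(x) = c₁ (1 - x) + c₂ (1 + x) + c₃ (1 - x²)`, where
`c = (c₁, c₂, c₃)` is encoded as `(c.1, c.2.1, c.2.2)`. -/
def P (c : ℝ × ℝ × ℝ) (x : ℝ) : ℝ :=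
  c.1 * (1 - x) + c.2.1 * (1 + x) + c.2.2 * (1 - x ^ 2)

/-- `U` is a `C¹` solution on `(-1, 1)` of
`(1 - x²) U' + 2 x U + U² / 2 = P_c(x)`. Only the values of `U` on `(-1, 1)` matter. -/
def IsSolution (c : ℝ × ℝ × ℝ) (U : ℝ → ℝ) : Prop :=
  ContDiffOn ℝ 1 U (Set.Ioo (-1) 1) ∧
    ∀ x ∈ Set.Ioo (-1 : ℝ) 1,
      (1 - x ^ 2) * deriv U x + 2 * x * U x + 1 / 2 * U x ^ 2 = P c x

/-- The critical value `c̄₃(c₁, c₂)`. -/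
def c3bar (c₁ c₂ : ℝ) : ℝ :=
  -(1 / 2) * (√(1 + c₁) + √(1 + c₂)) * (√(1 + c₁) + √(1 + c₂) + 2)

/-- The parameter set `J`. -/
def J : Set (ℝ × ℝ × ℝ) :=
  {c | -1 ≤ c.1 ∧ -1 ≤ c.2.1 ∧ c3bar c.1 c.2.1 ≤ c.2.2}

/-- The upper extremal solution `U⁺(c)`, as the pointwise supremum of all solutions. -/
def Uplus (c : ℝ × ℝ × ℝ) (x : ℝ) : ℝ :=
  sSup {y | ∃ U : ℝ → ℝ, IsSolution c U ∧ U x = y}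

/-- The lower extremal solution `U⁻(c)`, as the pointwise infimum of all solutions. -/
def Uminus (c : ℝ × ℝ × ℝ) (x : ℝ) : ℝ :=
  sInf {y | ∃ U : ℝ → ℝ, IsSolution c U ∧ U x = y}

/-- `γ⁺(c) = U⁺(c)(0)`. -/
def gammaPlus (c : ℝ × ℝ × ℝ) : ℝ := Uplus c 0

/-- `γ⁻(c) = U⁻(c)(0)`. -/
def gammaMinus (c : ℝ × ℝ × ℝ) : ℝ := Uminus c 0

end HomogNS

end

/-! With `s = √(1 + c₁)` and `z = (1 + x) / 2`, the substitution `U = (1 + s)(1 - x) + (1 - x²)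
v'(z) / v(z)` turns the Riccati equation into `z v'' + (1 + s) v' = (A / (1 - z) + B / (1 - z)²) v`,
where `A = (c₁ + 2 c₃) / 4` and `B = c₂ / 4`. The exponents at `z = 0` are `0` and `-s`; the
greatest solution comes from the regular solution `v`, `v(0) = 1`.

Three facts carry the proof. The coefficients of `v` solve a linear equation in a Banach space whose
operator is affine in `(s, A, B)` and invertible, so `v(1/2)` and `v'(1/2)` are smooth in `(s, A,
B)`, even across `s = 0` (`isUnit_recOp`, `contDiffAt_frob`, `contDiffAt_frob'`). Comparison with
`(1 - z) ^ β` gives `v > 0` exactly under the inequality `c₃ ≥ c̄₃` (`pos_of_ode`). A solution lying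
above that of `v` would force a positive quantity to `-∞` at `x = -1` (`le_riccati`).

Thus `γ⁺` is a smooth function of `(s, A, B)`. Only `s` can fail to be smooth in `c`, and only at
`c₁ = -1`; on that face it is constant. The reflection `U(x) ↦ -U(-x)` exchanges `c₁` and `c₂` and
yields `γ⁻`. -/

noncomputable section

namespace HomogNS

/-! ### Binomial weights -/

/-- The weight `C(n + M, M)`, the `n`-th coefficient of `(1 - z) ^ (-(M + 1))`. -/
def weight (M n : ℕ) : ℝ := ((n + M).choose M : ℝ)

lemma weight_pos (M n : ℕ) : 0 < weight M n := by
  unfold weight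
  exact_mod_cast Nat.choose_pos (Nat.le_add_left _ _)

lemma weight_zero (M : ℕ) : weight M 0 = 1 := by simp [weight]

lemma succ_mul_weight_succ (M n : ℕ) :
    ((n : ℝ) + 1) * weight M (n + 1) = (n + M + 1) * weight M n := by
  have h := Nat.add_one_mul_choose_eq (n + M) n
  have e1 : (n + 1 + M).choose M = (n + M + 1).choose (n + 1) := by
    rw [show n + 1 + M = n + M + 1 by ring]
    exact Nat.choose_symm_of_eq_add (by ring)
  have e2 : (n + M).choose M = (n + M).choose n := Nat.choose_symm_of_eq_add (by ring)
  unfold weight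
  rw [e1, e2]
  have h' : ((n + M + 1 : ℕ) : ℝ) * ((n + M).choose n : ℕ)
      = ((n + M + 1).choose (n + 1) : ℕ) * ((n + 1 : ℕ) : ℝ) := by exact_mod_cast h
  push_cast at h'
  linarith

lemma succ_mul_weight_succ' (M n : ℕ) :
    ((n : ℝ) + 1) * weight M (n + 1) = (M + 1) * weight (M + 1) n := by
  have h := Nat.choose_succ_right_eq (n + 1 + M) M
  unfold weight
  rw [show n + 1 + M - M = n + 1 by omega] at h
  rw [show n + (M + 1) = n + 1 + M by ring]
  have h' : (((n + 1 + M).choose (M + 1) : ℕ) : ℝ) * ((M + 1 : ℕ) : ℝ)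
      = ((n + 1 + M).choose M : ℕ) * ((n + 1 : ℕ) : ℝ) := by exact_mod_cast h
  push_cast at h'
  linarith

lemma sum_weight (M n : ℕ) :
    ((M : ℝ) + 1) * ∑ j ∈ Finset.range n, weight M j = n * weight M n := by
  induction n with
  | zero => simp
  | succ n ih =>
    rw [Finset.sum_range_succ, mul_add, ih]
    push_cast
    rw [succ_mul_weight_succ]
    ring

lemma sum_sub_mul_weight (M n : ℕ) :
    ((M : ℝ) + 1) * (M + 2) * ∑ j ∈ Finset.range n, ((n : ℝ) - j) * weight M j
      = n * (n + M + 1) * weight M n := by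
  induction n with
  | zero => simp
  | succ n ih =>
    have e : ∑ j ∈ Finset.range (n + 1), (((n + 1 : ℕ) : ℝ) - j) * weight M j
        = ∑ j ∈ Finset.range n, ((n : ℝ) - j) * weight M j
          + ∑ j ∈ Finset.range (n + 1), weight M j := by
      rw [Finset.sum_range_succ, Finset.sum_range_succ, ← add_assoc, ← Finset.sum_add_distrib]
      congr 1
      · refine Finset.sum_congr rfl fun j _ => ?_
        push_cast
        ring
      · push_cast
        ring
    have h1 := sum_weight M (n + 1)
    have h2 := succ_mul_weight_succ M n
    rw [e]
    push_cast at h1 ⊢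
    linear_combination ih + ((M : ℝ) + 2) * h1 - (n : ℝ) * h2

lemma summable_weight (M : ℕ) {r : ℝ} (hr : |r| < 1) : Summable fun n => weight M n * r ^ n :=
  summable_choose_mul_geometric_of_norm_lt_one M hr

/-! ### Power series with coefficients of polynomial growth -/

/-- `a` is dominated by a multiple of the weight of order `M`. -/
def Dominated (C : ℝ) (M : ℕ) (a : ℕ → ℝ) : Prop := ∀ n, |a n| ≤ C * weight M n

/-- Termwise differentiation costs one order of the weight, so the class is stable and can be
differentiated repeatedly. -/
lemma Dominated.succ_mul {C : ℝ} {M : ℕ} {a : ℕ → ℝ} (h : Dominated C M a) :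
    Dominated (C * (M + 1)) (M + 1) fun n => ((n : ℝ) + 1) * a (n + 1) := fun n => by
  have := h (n + 1)
  have e := succ_mul_weight_succ' M n
  have hn : (0 : ℝ) < (n : ℝ) + 1 := by positivity
  rw [abs_mul, abs_of_pos hn]
  calc ((n : ℝ) + 1) * |a (n + 1)| ≤ (n + 1) * (C * weight M (n + 1)) := by gcongr
    _ = C * ((n + 1) * weight M (n + 1)) := by ring
    _ = _ := by rw [e]; ring

lemma Dominated.summable {C : ℝ} {M : ℕ} {a : ℕ → ℝ} (h : Dominated C M a) {z : ℝ}
    (hz : |z| < 1) : Summable fun n => ‖a n * z ^ n‖ := by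
  refine Summable.of_nonneg_of_le (fun _ => norm_nonneg _) (fun n => ?_)
    ((summable_weight M (r := |z|) (by rwa [abs_abs])).mul_left C)
  rw [norm_mul, norm_pow, Real.norm_eq_abs, Real.norm_eq_abs, ← mul_assoc]
  gcongr
  exact h n

lemma Dominated.hasDerivAt {C : ℝ} {M : ℕ} {a : ℕ → ℝ} (h : Dominated C M a) {z : ℝ}
    (hz : |z| < 1) : HasDerivAt (fun z => ∑' n, a n * z ^ n)
      (∑' n : ℕ, ((n : ℝ) + 1) * a (n + 1) * z ^ n) z := by
  obtain ⟨r, hzr, hr⟩ := exists_between hz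
  have hr0 : 0 < r := (abs_nonneg z).trans_lt hzr
  have hs := h.succ_mul.summable (z := r) (by rwa [abs_of_pos hr0])
  have hu : Summable fun n : ℕ => ‖(n : ℝ) * a n * r ^ (n - 1)‖ := by
    rw [← summable_nat_add_iff 1]
    simpa using hs
  have key := hasDerivAt_tsum_of_isPreconnected (𝕜 := ℝ) (F := ℝ) hu (t := Metric.ball 0 r)
    (g := fun n z => a n * z ^ n) (g' := fun n z => (n : ℝ) * a n * z ^ (n - 1)) (y₀ := 0) (y := z)
    Metric.isOpen_ball (convex_ball (0 : ℝ) r).isPreconnected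
    (fun n y _ => ((hasDerivAt_pow n y).const_mul (a n)).congr_deriv (by ring))
    (fun n y hy => by
      rw [norm_mul, norm_mul _ (r ^ _), norm_pow, norm_pow]
      have : ‖y‖ ≤ ‖r‖ := by
        rw [Real.norm_of_nonneg hr0.le]
        exact (mem_ball_zero_iff.1 hy).le
      gcongr)
    (by simpa using hr0) (h.summable (by simp)).of_norm (by simpa using hzr)
  have hsz : Summable fun n : ℕ => (n : ℝ) * a n * z ^ (n - 1) := by
    rw [← summable_nat_add_iff 1]
    simpa using (h.succ_mul.summable hz).of_norm
  rw [hsz.tsum_eq_zero_add] at key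
  simpa using key

/-! ### Triangular operators on bounded sequences -/

open scoped BoundedContinuousFunction

/-- The Banach space of bounded real sequences. -/
def BddSeq : Type := ℕ →ᵇ ℝ

namespace BddSeq

instance : NormedAddCommGroup BddSeq := inferInstanceAs (NormedAddCommGroup (ℕ →ᵇ ℝ))
instance : NormedSpace ℝ BddSeq := inferInstanceAs (NormedSpace ℝ (ℕ →ᵇ ℝ))
instance : CompleteSpace BddSeq := inferInstanceAs (CompleteSpace (ℕ →ᵇ ℝ))
instance : CoeFun BddSeq fun _ => ℕ → ℝ := ⟨fun y => DFunLike.coe (F := ℕ →ᵇ ℝ) y⟩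

/-- The bounded sequence with the given terms. -/
def mk (f : ℕ → ℝ) (C : ℝ) (h : ∀ n, |f n| ≤ C) : BddSeq :=
  BoundedContinuousFunction.ofNormedAddCommGroupDiscrete f C h

@[simp] lemma mk_apply (f : ℕ → ℝ) (C : ℝ) (h : ∀ n, |f n| ≤ C) (n : ℕ) : mk f C h n = f n := rfl
@[simp] lemma add_apply (x y : BddSeq) (n : ℕ) : (x + y) n = x n + y n := rfl
@[simp] lemma smul_apply (c : ℝ) (y : BddSeq) (n : ℕ) : (c • y) n = c * y n := rfl

lemma ext {x y : BddSeq} (h : ∀ n, x n = y n) : x = y :=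
  BoundedContinuousFunction.ext (α := ℕ) (β := ℝ) h

lemma abs_apply_le (y : BddSeq) (n : ℕ) : |y n| ≤ ‖y‖ :=
  BoundedContinuousFunction.norm_coe_le_norm (α := ℕ) (β := ℝ) y n

lemma norm_le {y : BddSeq} {C : ℝ} (hC : 0 ≤ C) (h : ∀ n, |y n| ≤ C) : ‖y‖ ≤ C :=
  (BoundedContinuousFunction.norm_le (α := ℕ) (β := ℝ) hC).2 h

end BddSeq

lemma abs_sum_mul_le (k : ℕ → ℕ → ℝ) (C : ℝ) (hC : ∀ n, ∑ j ∈ Finset.range n, |k n j| ≤ C)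
    (y : BddSeq) (n : ℕ) : |∑ j ∈ Finset.range n, k n j * y j| ≤ C * ‖y‖ := by
  calc |∑ j ∈ Finset.range n, k n j * y j| ≤ ∑ j ∈ Finset.range n, |k n j| * ‖y‖ := by
        refine (Finset.abs_sum_le_sum_abs _ _).trans (Finset.sum_le_sum fun j _ => ?_)
        rw [abs_mul]
        gcongr
        exact y.abs_apply_le j
    _ ≤ C * ‖y‖ := by
        rw [← Finset.sum_mul]
        gcongr
        exact hC n

/-- The operator on bounded sequences with the strictly lower triangular matrix `k`. -/
def lowerOp (k : ℕ → ℕ → ℝ) (C : ℝ) (hC : ∀ n, ∑ j ∈ Finset.range n, |k n j| ≤ C) :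
    BddSeq →L[ℝ] BddSeq :=
  LinearMap.mkContinuous
    { toFun := fun y => .mk (fun n => ∑ j ∈ Finset.range n, k n j * y j) (C * ‖y‖)
        (abs_sum_mul_le k C hC y)
      map_add' := fun x y => BddSeq.ext fun n => by
        simp [mul_add, Finset.sum_add_distrib]
      map_smul' := fun c y => BddSeq.ext fun n => by
        simp [Finset.mul_sum, mul_left_comm] } C
    (fun y => BddSeq.norm_le (mul_nonneg (by simpa using hC 0) (norm_nonneg _))
      (abs_sum_mul_le k C hC y))

lemma norm_lowerOp_le (k : ℕ → ℕ → ℝ) (C : ℝ)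
    (hC : ∀ n, ∑ j ∈ Finset.range n, |k n j| ≤ C) : ‖lowerOp k C hC‖ ≤ C :=
  have hC0 : 0 ≤ C := by simpa using hC 0
  ContinuousLinearMap.opNorm_le_bound _ hC0 fun y =>
    BddSeq.norm_le (by positivity) (abs_sum_mul_le k C hC y)

lemma abs_one_div_natCast_le (n : ℕ) : |1 / (n : ℝ)| ≤ 1 := by
  rcases Nat.eq_zero_or_pos n with rfl | hn
  · simp
  · have : (1 : ℝ) ≤ n := by exact_mod_cast hn
    rw [abs_of_nonneg (by positivity), div_le_one (by positivity)]
    exact this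

/-- The gain `1 / (M + 1)` is the purpose of the weights: a large `M` makes the off-diagonal part of
the recurrence a contraction. -/
lemma sum_abs_sumKernel_le (M n : ℕ) :
    ∑ j ∈ Finset.range n, |weight M j / (n * weight M n)| ≤ 1 / ((M : ℝ) + 1) := by
  rcases Nat.eq_zero_or_pos n with rfl | hn
  · simp
    positivity
  have hn' : (0 : ℝ) < n := by exact_mod_cast hn
  have hw := weight_pos M n
  refine le_of_eq ?_
  rw [Finset.sum_congr rfl fun j _ => abs_of_pos (div_pos (weight_pos M j) (mul_pos hn' hw)),
    ← Finset.sum_div, div_eq_div_iff (by positivity) (by positivity)]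
  linear_combination sum_weight M n

lemma sum_abs_convKernel_le (M n : ℕ) :
    ∑ j ∈ Finset.range n, |((n : ℝ) - j) * weight M j / (n ^ 2 * weight M n)|
      ≤ 1 / ((M : ℝ) + 1) := by
  rcases Nat.eq_zero_or_pos n with rfl | hn
  · simp
    positivity
  have hn' : (1 : ℝ) ≤ n := by exact_mod_cast hn
  have hw := weight_pos M n
  have hpos : ∀ j ∈ Finset.range n,
      |((n : ℝ) - j) * weight M j / (n ^ 2 * weight M n)|
        = ((n : ℝ) - j) * weight M j / (n ^ 2 * weight M n) := fun j hj => by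
    have : (j : ℝ) ≤ n := by exact_mod_cast (Finset.mem_range.1 hj).le
    have := weight_pos M j
    exact abs_of_nonneg (div_nonneg (mul_nonneg (by linarith) this.le) (by positivity))
  rw [Finset.sum_congr rfl hpos, ← Finset.sum_div, div_le_div_iff₀ (by positivity) (by positivity)]
  have h := sum_sub_mul_weight M n
  -- For `n ≥ 1`, `n + M + 1 ≤ (M + 2) n`; this absorbs the extra factor in the sum identity.
  have h2 : (n : ℝ) * (n + M + 1) * weight M n ≤ (M + 2) * (n ^ 2 * weight M n) := by
    have : (n : ℝ) * (n + M + 1) ≤ (M + 2) * n ^ 2 := by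
      have : (0 : ℝ) ≤ n * ((M + 1) * (n - 1)) := by
        have : (0 : ℝ) ≤ n - 1 := by linarith
        positivity
      nlinarith
    nlinarith
  have hM : (0 : ℝ) < M + 2 := by positivity
  refine le_of_mul_le_mul_left ?_ hM
  linarith

/-- The operator with matrix `ω j / (n ω n)`, `j < n`. -/
def sumOp (M : ℕ) : BddSeq →L[ℝ] BddSeq := lowerOp _ _ (sum_abs_sumKernel_le M)

/-- The operator with matrix `(n - j) ω j / (n² ω n)`, `j < n`. -/
def convOp (M : ℕ) : BddSeq →L[ℝ] BddSeq := lowerOp _ _ (sum_abs_convKernel_le M)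

lemma abs_mul_apply_le {d : ℕ → ℝ} (hd : ∀ n, |d n| ≤ 1) (y : BddSeq) (n : ℕ) :
    |d n * y n| ≤ 1 * ‖y‖ := by
  rw [abs_mul]
  exact mul_le_mul (hd n) (y.abs_apply_le n) (abs_nonneg _) zero_le_one

/-- The diagonal operator with entries `d n`. -/
def diagOp (d : ℕ → ℝ) (hd : ∀ n, |d n| ≤ 1) : BddSeq →L[ℝ] BddSeq :=
  LinearMap.mkContinuous
    { toFun := fun y => .mk (fun n => d n * y n) (1 * ‖y‖) (abs_mul_apply_le hd y)
      map_add' := fun x y => BddSeq.ext fun n => by simp [mul_add]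
      map_smul' := fun c y => BddSeq.ext fun n => by simp [mul_left_comm] } 1
    (fun y => BddSeq.norm_le (by positivity) (abs_mul_apply_le hd y))

@[simp] lemma diagOp_apply (d : ℕ → ℝ) (hd : ∀ n, |d n| ≤ 1) (y : BddSeq) (n : ℕ) :
    diagOp d hd y n = d n * y n := rfl

lemma norm_diagOp_le (d : ℕ → ℝ) (hd : ∀ n, |d n| ≤ 1) : ‖diagOp d hd‖ ≤ 1 :=
  ContinuousLinearMap.opNorm_le_bound _ zero_le_one fun y =>
    BddSeq.norm_le (by positivity) (abs_mul_apply_le hd y)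

/-- The diagonal operator with entries `1 / n`. -/
def recipOp : BddSeq →L[ℝ] BddSeq := diagOp _ abs_one_div_natCast_le

/-! ### Invertibility of the recurrence operator -/

/-- The operator whose inverse image of the first unit vector is the weighted coefficient sequence
of the Frobenius solution; the parameters are `p = (s, A, B)`. -/
def recOp (M : ℕ) (p : ℝ × ℝ × ℝ) : BddSeq →L[ℝ] BddSeq :=
  1 + p.1 • recipOp - p.2.1 • (recipOp * sumOp M) - p.2.2 • convOp M

lemma contDiff_recOp (M : ℕ) : ContDiff ℝ ∞ (recOp M) := by
  unfold recOp
  fun_prop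

/-- The diagonal part `1 + s / n` has an inverse of norm at most `1` because `s ≥ 0`; the remainder
has norm at most `(|A| + |B|) / (M + 1) < 1`, so a Neumann series applies. -/
lemma isUnit_recOp {M : ℕ} {p : ℝ × ℝ × ℝ} (hs : 0 ≤ p.1) (hM : |p.2.1| + |p.2.2| < M + 1) :
    IsUnit (recOp M p) := by
  -- At `n = 0` the convention `1 / 0 = 0` makes the diagonal entry `1`, so row `0` reads `y 0 = 1`.
  have hle : ∀ n : ℕ, |1 / (1 + p.1 * (1 / (n : ℝ)))| ≤ 1 := fun n => by
    have : 0 ≤ p.1 * (1 / (n : ℝ)) := by positivity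
    rw [abs_of_nonneg (by positivity), div_le_one (by positivity)]
    linarith
  have hinv : ∀ n : ℕ, (1 + p.1 * (1 / (n : ℝ))) * (1 / (1 + p.1 * (1 / (n : ℝ)))) = 1 :=
    fun n => by
      have : 0 ≤ p.1 * (1 / (n : ℝ)) := by positivity
      exact mul_one_div_cancel (by positivity)
  have hK : ‖recipOp‖ ≤ 1 := norm_diagOp_le _ _
  set R := diagOp _ hle with hR
  have hR1 : ‖R‖ ≤ 1 := norm_diagOp_le _ _
  set D : BddSeq →L[ℝ] BddSeq := 1 + p.1 • recipOp with hD
  have hDR : D * R = 1 := ContinuousLinearMap.ext fun y => BddSeq.ext fun n => by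
    have := hinv n
    simp only [hD, hR, mul_apply_eq_comp, add_apply, one_apply_eq_self, smul_apply, diagOp_apply,
      BddSeq.add_apply, BddSeq.smul_apply, recipOp]
    linear_combination (y n) * this
  have hRD : R * D = 1 := ContinuousLinearMap.ext fun y => BddSeq.ext fun n => by
    have := hinv n
    simp only [hD, hR, mul_apply_eq_comp, add_apply, one_apply_eq_self, smul_apply, diagOp_apply,
      BddSeq.add_apply, BddSeq.smul_apply, recipOp]
    linear_combination (y n) * this
  set T := p.2.1 • (recipOp * sumOp M) + p.2.2 • convOp M with hT
  have hTn : ‖R * T‖ < 1 := by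
    have h1 : ‖recipOp * sumOp M‖ ≤ 1 / ((M : ℝ) + 1) :=
      (norm_mul_le _ _).trans <| (mul_le_of_le_one_left (norm_nonneg _) hK).trans
        (norm_lowerOp_le _ _ _)
    have h2 : ‖convOp M‖ ≤ 1 / ((M : ℝ) + 1) := norm_lowerOp_le _ _ _
    calc ‖R * T‖ ≤ ‖T‖ :=
          (norm_mul_le _ _).trans (mul_le_of_le_one_left (norm_nonneg _) hR1)
      _ ≤ |p.2.1| * (1 / ((M : ℝ) + 1)) + |p.2.2| * (1 / ((M : ℝ) + 1)) := by
          refine (norm_add_le _ _).trans ?_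
          rw [norm_smul, norm_smul, Real.norm_eq_abs, Real.norm_eq_abs]
          gcongr
      _ < 1 := by
          rw [← add_mul, mul_one_div, div_lt_one (by positivity)]
          exact hM
  have hfac : recOp M p = D * (1 - R * T) := by
    rw [mul_sub, ← mul_assoc, hDR, mul_one, one_mul, hT, recOp, ← hD, sub_sub]
  rw [hfac]
  exact (show IsUnit D from ⟨⟨D, R, hDR, hRD⟩, rfl⟩).mul (isUnit_one_sub_of_norm_lt_one hTn)

/-- The first unit vector. -/
def unitSeq : BddSeq :=
  .mk (fun n => if n = 0 then 1 else 0) 1 fun n => by split_ifs <;> simp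

/-- The coefficients of the Frobenius solution divided by the weights `C(n + M, M)`. -/
def weightedCoeff (M : ℕ) (p : ℝ × ℝ × ℝ) : BddSeq := Ring.inverse (recOp M p) unitSeq

/-- The coefficients of the Frobenius solution. -/
def coeff (M : ℕ) (p : ℝ × ℝ × ℝ) (n : ℕ) : ℝ := weight M n * weightedCoeff M p n

/-- Inversion in a Banach algebra is smooth at units. The statement concerns a full neighbourhood of
`p`, including `s < 0`, which gives smoothness up to the boundary of `J`. -/
lemma contDiffAt_weightedCoeff {M : ℕ} {p : ℝ × ℝ × ℝ} (h : IsUnit (recOp M p)) :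
    ContDiffAt ℝ ∞ (weightedCoeff M) p := by
  obtain ⟨u, hu⟩ := h
  have h1 : ContDiffAt ℝ ∞ Ring.inverse (recOp M p) := hu ▸ contDiffAt_ringInverse ℝ u
  exact (h1.comp p (contDiff_recOp M).contDiffAt).clm_apply contDiffAt_const

lemma coeff_dominated (M : ℕ) (p : ℝ × ℝ × ℝ) : Dominated ‖weightedCoeff M p‖ M (coeff M p) :=
  fun n => by
    rw [coeff, abs_mul, abs_of_pos (weight_pos M n), mul_comm]
    exact mul_le_mul_of_nonneg_right (BddSeq.abs_apply_le _ n) (weight_pos M n).le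

lemma recOp_weightedCoeff {M : ℕ} {p : ℝ × ℝ × ℝ} (h : IsUnit (recOp M p)) :
    recOp M p (weightedCoeff M p) = unitSeq := by
  rw [weightedCoeff, ← mul_apply_eq_comp, Ring.mul_inverse_cancel _ h, one_apply_eq_self]

lemma weightedCoeff_rec {M : ℕ} {p : ℝ × ℝ × ℝ} (h : IsUnit (recOp M p)) (n : ℕ) :
    weightedCoeff M p n + p.1 * (1 / n * weightedCoeff M p n)
      - p.2.1 * (1 / n * ∑ j ∈ Finset.range n, weight M j / (n * weight M n) * weightedCoeff M p j)
      - p.2.2 * ∑ j ∈ Finset.range n,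
          ((n : ℝ) - j) * weight M j / (n ^ 2 * weight M n) * weightedCoeff M p j
      = if n = 0 then 1 else 0 :=
  congrArg (fun y : BddSeq => y n) (recOp_weightedCoeff h)

lemma coeff_zero {M : ℕ} {p : ℝ × ℝ × ℝ} (h : IsUnit (recOp M p)) : coeff M p 0 = 1 := by
  have := weightedCoeff_rec h 0
  simpa [coeff, weight_zero] using this

/-- Row `n + 1` of the operator equation times `(n + 1)² * weight M (n + 1)`: the Frobenius
recurrence, as `A / (1 - z) + B / (1 - z)²` has coefficients `A + B (k + 1)`. -/
lemma coeff_rec {M : ℕ} {p : ℝ × ℝ × ℝ} (h : IsUnit (recOp M p)) (n : ℕ) :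
    ((n : ℝ) + 1) * (n + 1 + p.1) * coeff M p (n + 1)
      = ∑ j ∈ Finset.range (n + 1), coeff M p j * (p.2.1 + p.2.2 * (((n - j : ℕ) : ℝ) + 1)) := by
  have h0 := weightedCoeff_rec h (n + 1)
  set y := weightedCoeff M p with hy
  have hw := (weight_pos M (n + 1)).ne'
  have hn : ((n : ℝ) + 1) ≠ 0 := by positivity
  have e1 : ∑ j ∈ Finset.range (n + 1), weight M j / (((n + 1 : ℕ) : ℝ) * weight M (n + 1)) * y j
      = (∑ j ∈ Finset.range (n + 1), coeff M p j) / ((n + 1) * weight M (n + 1)) := by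
    rw [Finset.sum_div]
    refine Finset.sum_congr rfl fun j _ => ?_
    rw [coeff, ← hy]
    push_cast
    ring
  have e2 : ∑ j ∈ Finset.range (n + 1), (((n + 1 : ℕ) : ℝ) - j) * weight M j /
        (((n + 1 : ℕ) : ℝ) ^ 2 * weight M (n + 1)) * y j
      = (∑ j ∈ Finset.range (n + 1), coeff M p j * (((n - j : ℕ) : ℝ) + 1))
        / ((n + 1) ^ 2 * weight M (n + 1)) := by
    rw [Finset.sum_div]
    refine Finset.sum_congr rfl fun j hj => ?_
    rw [coeff, ← hy, Nat.cast_sub (Nat.lt_succ_iff.1 (Finset.mem_range.1 hj))]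
    push_cast
    ring
  rw [e1, e2, if_neg (Nat.succ_ne_zero n)] at h0
  push_cast at h0
  have e3 : ∑ j ∈ Finset.range (n + 1), coeff M p j * (p.2.1 + p.2.2 * (((n - j : ℕ) : ℝ) + 1))
      = p.2.1 * ∑ j ∈ Finset.range (n + 1), coeff M p j
        + p.2.2 * ∑ j ∈ Finset.range (n + 1), coeff M p j * (((n - j : ℕ) : ℝ) + 1) := by
    rw [Finset.mul_sum, Finset.mul_sum, ← Finset.sum_add_distrib]
    exact Finset.sum_congr rfl fun j _ => by ring
  rw [e3, coeff, ← hy]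
  field_simp at h0
  linear_combination h0

/-! ### The Frobenius solution and its dependence on parameters -/

/-- The Frobenius solution normalized by `v 0 = 1`. -/
def frob (M : ℕ) (p : ℝ × ℝ × ℝ) (z : ℝ) : ℝ := ∑' n, coeff M p n * z ^ n

/-- The derivative of the Frobenius solution. -/
def frob' (M : ℕ) (p : ℝ × ℝ × ℝ) (z : ℝ) : ℝ :=
  ∑' n : ℕ, ((n : ℝ) + 1) * coeff M p (n + 1) * z ^ n

/-- The second derivative of the Frobenius solution. -/
def frob'' (M : ℕ) (p : ℝ × ℝ × ℝ) (z : ℝ) : ℝ :=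
  ∑' n : ℕ, ((n : ℝ) + 1) * (((n + 1 : ℕ) + 1) * coeff M p (n + 1 + 1)) * z ^ n

lemma hasDerivAt_frob (M : ℕ) (p : ℝ × ℝ × ℝ) {z : ℝ} (hz : |z| < 1) :
    HasDerivAt (frob M p) (frob' M p z) z :=
  (coeff_dominated M p).hasDerivAt hz

lemma hasDerivAt_frob' (M : ℕ) (p : ℝ × ℝ × ℝ) {z : ℝ} (hz : |z| < 1) :
    HasDerivAt (frob' M p) (frob'' M p z) z :=
  (coeff_dominated M p).succ_mul.hasDerivAt hz

lemma frob_zero {M : ℕ} {p : ℝ × ℝ × ℝ} (h : IsUnit (recOp M p)) : frob M p 0 = 1 := by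
  rw [frob, tsum_eq_single 0 (by simp +contextual)]
  simp [coeff_zero h]

lemma summable_affine_mul_pow (a b : ℝ) {z : ℝ} (hz : |z| < 1) :
    Summable fun n : ℕ => ‖(a + b * ((n : ℝ) + 1)) * z ^ n‖ := by
  have h : Dominated (|a| + |b|) 1 fun n : ℕ => a + b * ((n : ℝ) + 1) := fun n => by
    have hw : weight 1 n = n + 1 := by simp [weight]
    rw [hw]
    have hn : (0 : ℝ) ≤ n := n.cast_nonneg
    calc |a + b * ((n : ℝ) + 1)| ≤ |a| + |b * ((n : ℝ) + 1)| := abs_add_le _ _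
      _ = |a| + |b| * (n + 1) := by rw [abs_mul, abs_of_pos (by positivity : (0 : ℝ) < n + 1)]
      _ ≤ _ := by nlinarith [abs_nonneg a]
  exact h.summable hz

lemma tsum_affine_mul_pow (a b : ℝ) {z : ℝ} (hz : |z| < 1) :
    ∑' n : ℕ, (a + b * ((n : ℝ) + 1)) * z ^ n = a / (1 - z) + b / (1 - z) ^ 2 := by
  have h1 := hasSum_geometric_of_abs_lt_one hz
  have h2 := hasSum_coe_mul_geometric_of_norm_lt_one (r := z) hz
  have h3 : (1 - z) ≠ 0 := by linarith [(abs_lt.1 hz).2]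
  have h := (h1.mul_left (a + b)).add (h2.mul_left b)
  have e : (fun n : ℕ => (a + b * ((n : ℝ) + 1)) * z ^ n)
      = fun n : ℕ => (a + b) * z ^ n + b * (n * z ^ n) := by
    ext n
    ring
  rw [e, h.tsum_eq]
  field_simp
  ring

/-- The Frobenius solution solves `z v'' + (1 + s) v' = (A / (1 - z) + B / (1 - z)²) v`. -/
lemma frob_ode {M : ℕ} {p : ℝ × ℝ × ℝ} (h : IsUnit (recOp M p)) {z : ℝ} (hz : |z| < 1) :
    z * frob'' M p z + (1 + p.1) * frob' M p z
      = (p.2.1 / (1 - z) + p.2.2 / (1 - z) ^ 2) * frob M p z := by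
  have hd := coeff_dominated M p
  have s1 := (hd.succ_mul.summable hz).of_norm
  have s2 := (hd.succ_mul.succ_mul.summable hz).of_norm
  have hs : Summable fun n : ℕ => (n : ℝ) * (((n : ℝ) + 1) * coeff M p (n + 1)) * z ^ n := by
    rw [← summable_nat_add_iff 1]
    refine (s2.mul_left z).congr fun n => ?_
    push_cast
    ring
  have e1 : z * frob'' M p z = ∑' n : ℕ, (n : ℝ) * (((n : ℝ) + 1) * coeff M p (n + 1)) * z ^ n := by
    rw [hs.tsum_eq_zero_add, frob'', ← tsum_mul_left]
    simp only [Nat.cast_zero, zero_mul, zero_add]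
    refine tsum_congr fun n => ?_
    push_cast
    ring
  rw [e1, frob', ← tsum_mul_left, ← hs.tsum_add (s1.mul_left _), ← tsum_affine_mul_pow _ _ hz, frob,
    mul_comm (∑' _, _), tsum_mul_tsum_eq_tsum_sum_range_of_summable_norm (hd.summable hz)
      (summable_affine_mul_pow _ _ hz)]
  refine tsum_congr fun n => ?_
  have hr := coeff_rec h n
  have e : ∑ k ∈ Finset.range (n + 1), coeff M p k * z ^ k
        * ((p.2.1 + p.2.2 * (((n - k : ℕ) : ℝ) + 1)) * z ^ (n - k))
      = (∑ j ∈ Finset.range (n + 1), coeff M p j * (p.2.1 + p.2.2 * (((n - j : ℕ) : ℝ) + 1)))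
        * z ^ n := by
    rw [Finset.sum_mul]
    refine Finset.sum_congr rfl fun k hk => ?_
    rw [← pow_mul_pow_sub z (Nat.lt_succ_iff.1 (Finset.mem_range.1 hk))]
    ring
  rw [e, ← hr]
  ring

/-- The functional `y ↦ ∑ w n y (n + i)` for summable `w`. -/
lemma exists_tsum_clm {w : ℕ → ℝ} (hw : Summable fun n => |w n|) (i : ℕ) :
    ∃ φ : BddSeq →L[ℝ] ℝ, ∀ y, φ y = ∑' n, w n * y (n + i) := by
  have hle : ∀ (y : BddSeq) n, ‖w n * y (n + i)‖ ≤ |w n| * ‖y‖ := fun y n => by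
    rw [norm_mul]
    exact mul_le_mul_of_nonneg_left (y.abs_apply_le _) (abs_nonneg _)
  have hs : ∀ y : BddSeq, Summable fun n => w n * y (n + i) := fun y =>
    Summable.of_norm_bounded (hw.mul_right ‖y‖) (hle y)
  refine ⟨LinearMap.mkContinuous
    { toFun := fun y => ∑' n, w n * y (n + i)
      map_add' := fun x y => by
        rw [← (hs x).tsum_add (hs y)]
        simp [mul_add]
      map_smul' := fun c y => by
        rw [RingHom.id_apply, smul_eq_mul, ← tsum_mul_left]
        simp [mul_left_comm] } (∑' n, |w n|) (fun y => ?_), fun y => rfl⟩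
  rw [← tsum_mul_right]
  exact tsum_of_norm_bounded (hw.mul_right ‖y‖).hasSum (hle y)

lemma contDiffAt_frob {M : ℕ} {p : ℝ × ℝ × ℝ} (h : IsUnit (recOp M p)) {z : ℝ} (hz : |z| < 1) :
    ContDiffAt ℝ ∞ (fun q => frob M q z) p := by
  have hw : Dominated 1 M (weight M) := fun n => by
    rw [abs_of_pos (weight_pos M n), one_mul]
  obtain ⟨φ, hφ⟩ := exists_tsum_clm (hw.summable hz) 0
  have e : (fun q => frob M q z) = fun q => φ (weightedCoeff M q) := by
    ext q
    rw [hφ, frob]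
    exact tsum_congr fun n => by rw [coeff, add_zero]; ring
  rw [e]
  exact φ.contDiff.contDiffAt.comp p (contDiffAt_weightedCoeff h)

lemma contDiffAt_frob' {M : ℕ} {p : ℝ × ℝ × ℝ} (h : IsUnit (recOp M p)) {z : ℝ} (hz : |z| < 1) :
    ContDiffAt ℝ ∞ (fun q => frob' M q z) p := by
  have hw : Dominated 1 M (weight M) := fun n => by
    rw [abs_of_pos (weight_pos M n), one_mul]
  obtain ⟨φ, hφ⟩ := exists_tsum_clm (hw.succ_mul.summable hz) 1
  have e : (fun q => frob' M q z) = fun q => φ (weightedCoeff M q) := by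
    ext q
    rw [hφ, frob']
    exact tsum_congr fun n => by rw [coeff]; ring
  rw [e]
  exact φ.contDiff.contDiffAt.comp p (contDiffAt_weightedCoeff h)

/-! ### Positivity of the Frobenius solution -/

open Set

/-- Positivity of the Frobenius solution by comparison with `(1 - z) ^ β`. -/
lemma pos_of_ode {v v₁ v₂ : ℝ → ℝ} {s A B β : ℝ} (hs : 0 ≤ s)
    (h₁ : ∀ z ∈ Ico (0 : ℝ) 1, HasDerivAt v (v₁ z) z)
    (h₂ : ∀ z ∈ Ico (0 : ℝ) 1, HasDerivAt v₁ (v₂ z) z)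
    (ode : ∀ z ∈ Ico (0 : ℝ) 1, z * v₂ z + (1 + s) * v₁ z = (A / (1 - z) + B / (1 - z) ^ 2) * v z)
    (hv : v 0 = 1) (hB : β * (β - 1) = B) (hm : 0 ≤ A + B + β * (1 + s)) :
    ∀ z ∈ Ico (0 : ℝ) 1, 0 < v z := by
  have hvc : ContinuousOn v (Ico 0 1) := fun z hz => (h₁ z hz).continuousAt.continuousWithinAt
  have step : ∀ w ∈ Ico (0 : ℝ) 1, (∀ z ∈ Ico 0 w, 0 < v z) → 0 < v w := by
    intro w hw hpos
    have hsub : ∀ z ∈ Icc 0 w, z ∈ Ico (0 : ℝ) 1 := fun z hz => ⟨hz.1, hz.2.trans_lt hw.2⟩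
    -- `W = (1 - z) ^ (β + 1) * (v * (1 - z) ^ (-β))'`, so its sign decides the monotonicity of `v /
    -- (1 - z) ^ β`.
    set W : ℝ → ℝ := fun z => (1 - z) * v₁ z + β * v z with hW
    have hlin : ∀ z : ℝ, HasDerivAt (fun z => 1 - z) (-1) z := fun z => by
      simpa using (hasDerivAt_id z).const_sub 1
    have hWd : ∀ z ∈ Ico (0 : ℝ) 1,
        HasDerivAt W (-1 * v₁ z + (1 - z) * v₂ z + β * v₁ z) z := fun z hz =>
      ((hlin z).mul (h₂ z hz)).add ((h₁ z hz).const_mul β)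
    -- With this integrating factor the equation gives `N'` as a nonnegative multiple of `v`, by `β
    -- (β - 1) = B` and `hm`; and `N 0 = 0` since `1 + s > 0`.
    set N : ℝ → ℝ := fun z => z ^ (1 + s) * (1 - z) ^ (β - 1) * W z with hN
    have hNd : ∀ z ∈ Ioo 0 w, HasDerivAt N
        (z ^ s * (1 - z) ^ (β - 1) * ((A + B + β * (1 + s)) * v z)) z := by
      intro z hz
      have hz1 : z ∈ Ico (0 : ℝ) 1 := hsub z ⟨hz.1.le, hz.2.le⟩
      have hz0 : 0 < 1 - z := by linarith [hz1.2]
      have d1 := Real.hasDerivAt_rpow_const (x := z) (p := 1 + s) (Or.inl hz.1.ne')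
      have d2 := (hlin z).rpow_const (p := β - 1) (Or.inl hz0.ne')
      refine ((d1.mul d2).mul (hWd z hz1)).congr_deriv ?_
      have o := ode z hz1
      have e1 : z ^ (1 + s) = z ^ s * z := by
        rw [add_comm, Real.rpow_add hz.1, Real.rpow_one]
      have e2 : (1 - z) ^ (β - 1) = (1 - z) ^ (β - 1 - 1) * (1 - z) := by
        conv_rhs => rw [← Real.rpow_add_one hz0.ne', sub_add_cancel]
      simp only [Pi.mul_apply]
      rw [show 1 + s - 1 = s by ring, e1, e2]
      generalize (1 - z) ^ (β - 1 - 1) = b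
      generalize z ^ s = a
      have o' : z * v₂ z * (1 - z) ^ 2 = (A * (1 - z) + B) * v z - (1 + s) * v₁ z * (1 - z) ^ 2 := by
        have : (A / (1 - z) + B / (1 - z) ^ 2) * v z * (1 - z) ^ 2
            = (A * (1 - z) + B) * v z := by field_simp
        linear_combination (1 - z) ^ 2 * o + this
      rw [← hB] at o' ⊢
      simp only [hW]
      linear_combination a * b * o'
    have hNc : ContinuousOn N (Icc 0 w) := by
      intro z hz
      have hz0 : 1 - z ≠ 0 := by linarith [(hsub z hz).2]
      refine ContinuousAt.continuousWithinAt ?_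
      exact ((Real.continuousAt_rpow_const _ _ (Or.inr (by linarith))).mul
        ((hlin z).continuousAt.rpow_const (Or.inl hz0))).mul (hWd z (hsub z hz)).continuousAt
    have hNm : MonotoneOn N (Icc 0 w) := by
      refine monotoneOn_of_deriv_nonneg (convex_Icc 0 w) hNc ?_ ?_ <;> rw [interior_Icc] <;>
        intro z hz
      · exact (hNd z hz).differentiableAt.differentiableWithinAt
      · rw [(hNd z hz).deriv]
        have h1 := hpos z ⟨hz.1.le, hz.2⟩
        have h2 : 0 < 1 - z := by linarith [hz.2, hw.2]
        have h3 := hz.1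
        positivity
    have hWpos : ∀ z ∈ Ioo 0 w, 0 ≤ W z := by
      intro z hz
      have h0 : N 0 = 0 := by
        simp only [hN]
        rw [Real.zero_rpow (by linarith)]
        ring
      have h := hNm ⟨le_rfl, hw.1⟩ ⟨hz.1.le, hz.2.le⟩ hz.1.le
      rw [h0] at h
      have h2 : 0 < 1 - z := by linarith [hz.2, hw.2]
      exact nonneg_of_mul_nonneg_right h
        (mul_pos (Real.rpow_pos_of_pos hz.1 _) (Real.rpow_pos_of_pos h2 _))
    have hg : ∀ z ∈ Icc 0 w, HasDerivAt (fun z => v z * (1 - z) ^ (-β))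
        ((1 - z) ^ (-β - 1) * W z) z := by
      intro z hz
      have hz0 : 0 < 1 - z := by linarith [(hsub z hz).2]
      refine ((h₁ z (hsub z hz)).mul ((hlin z).rpow_const (p := -β) (Or.inl hz0.ne'))).congr_deriv ?_
      have e2 : (1 - z) ^ (-β) = (1 - z) ^ (-β - 1) * (1 - z) := by
        conv_rhs => rw [← Real.rpow_add_one hz0.ne', sub_add_cancel]
      rw [e2]
      simp only [hW]
      ring
    have hgm : MonotoneOn (fun z => v z * (1 - z) ^ (-β)) (Icc 0 w) := by
      refine monotoneOn_of_deriv_nonneg (convex_Icc 0 w)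
        (fun z hz => (hg z hz).continuousAt.continuousWithinAt) ?_ ?_ <;> rw [interior_Icc] <;>
        intro z hz
      · exact (hg z (Ioo_subset_Icc_self hz)).differentiableAt.differentiableWithinAt
      · rw [(hg z (Ioo_subset_Icc_self hz)).deriv]
        have h2 : 0 < 1 - z := by linarith [hz.2, hw.2]
        exact mul_nonneg (Real.rpow_pos_of_pos h2 _).le (hWpos z hz)
    have h := hgm ⟨le_rfl, hw.1⟩ ⟨hw.1, le_rfl⟩ hw.1
    simp only [hv, sub_zero, Real.one_rpow, mul_one] at h
    have h2 : 0 < 1 - w := by linarith [hw.2]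
    exact pos_of_mul_pos_left (zero_lt_one.trans_le h) (Real.rpow_pos_of_pos h2 _).le
  intro z hz
  by_contra hcon
  have hsub : Icc 0 z ⊆ Ico (0 : ℝ) 1 := fun y hy => ⟨hy.1, hy.2.trans_lt hz.2⟩
  have hcl : IsClosed (Icc 0 z ∩ v ⁻¹' Iic 0) :=
    (hvc.mono hsub).preimage_isClosed_of_isClosed isClosed_Icc isClosed_Iic
  have hcomp : IsCompact (Icc 0 z ∩ v ⁻¹' Iic 0) :=
    isCompact_Icc.of_isClosed_subset hcl inter_subset_left
  -- The first point where `v ≤ 0` contradicts `step`.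
  obtain ⟨w, hw, hmin⟩ := hcomp.exists_isLeast ⟨z, ⟨hz.1, le_rfl⟩, not_lt.1 hcon⟩
  refine absurd (step w (hsub hw.1) fun y hy => ?_) (not_lt.2 hw.2)
  by_contra hy'
  exact absurd (hmin ⟨⟨hy.1, hy.2.le.trans hw.1.2⟩, not_lt.1 hy'⟩) (not_le.2 hy.2)

/-! ### The Riccati equation and maximality -/

/-- A solution of `D' = a D` on an open interval which is positive at one point is positive. -/
lemma pos_of_linear_ode {D a : ℝ → ℝ} {l r x₀ : ℝ} (ha : ContinuousOn a (Ioo l r))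
    (hD : ∀ x ∈ Ioo l r, HasDerivAt D (a x * D x) x) (hx₀ : x₀ ∈ Ioo l r) (h0 : 0 < D x₀) :
    ∀ x ∈ Ioo l r, 0 < D x := by
  have hI : ∀ x ∈ Ioo l r, HasDerivAt (fun x => ∫ t in x₀..x, a t) (a x) x := fun x hx =>
    intervalIntegral.integral_hasDerivAt_right
      ((ha.mono (OrdConnected.uIcc_subset ordConnected_Ioo hx₀ hx)).intervalIntegrable)
      (ha.stronglyMeasurableAtFilter isOpen_Ioo x hx) (ha.continuousAt (isOpen_Ioo.mem_nhds hx))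
  have hG : ∀ x ∈ Ioo l r, HasDerivAt (fun x => D x * Real.exp (-∫ t in x₀..x, a t)) 0 x :=
    fun x hx => ((hD x hx).mul (hI x hx).neg.exp).congr_deriv (by ring)
  intro x hx
  have h := isOpen_Ioo.is_const_of_deriv_eq_zero isPreconnected_Ioo
    (fun y hy => (hG y hy).differentiableAt.differentiableWithinAt)
    (fun y hy => (hG y hy).deriv) hx hx₀
  simp only [intervalIntegral.integral_same, neg_zero, Real.exp_zero, mul_one] at h
  exact pos_of_mul_pos_left (h ▸ h0) (Real.exp_pos _).le

lemma one_sub_sq_pos {x : ℝ} (hx : x ∈ Ioo (-1 : ℝ) 1) : 0 < 1 - x ^ 2 := by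
  nlinarith [hx.1, hx.2]

lemma isSolution_iff {c : ℝ × ℝ × ℝ} {U : ℝ → ℝ} : IsSolution c U ↔ ∀ x ∈ Ioo (-1 : ℝ) 1,
    HasDerivAt U ((P c x - 2 * x * U x - 1 / 2 * U x ^ 2) / (1 - x ^ 2)) x := by
  constructor
  · rintro ⟨h1, h2⟩ x hx
    have hd := ((h1.differentiableOn one_ne_zero).differentiableAt
      (isOpen_Ioo.mem_nhds hx)).hasDerivAt
    refine hd.congr_deriv ?_
    rw [eq_div_iff (one_sub_sq_pos hx).ne']
    linear_combination h2 x hx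
  · intro h
    have hd : DifferentiableOn ℝ U (Ioo (-1) 1) := fun x hx =>
      (h x hx).differentiableAt.differentiableWithinAt
    refine ⟨(contDiffOn_one_iff_derivWithin isOpen_Ioo.uniqueDiffOn).2 ⟨hd, ?_⟩, fun x hx => ?_⟩
    · have hc := hd.continuousOn
      refine ContinuousOn.congr (f := fun x =>
        (P c x - 2 * x * U x - 1 / 2 * U x ^ 2) / (1 - x ^ 2)) ?_ fun x hx =>
          (h x hx).hasDerivWithinAt.derivWithin (isOpen_Ioo.uniqueDiffOn x hx)
      unfold P
      exact ContinuousOn.div (by fun_prop) (by fun_prop) fun x hx => (one_sub_sq_pos hx).ne'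
    · rw [(h x hx).deriv, mul_div_cancel₀ _ (one_sub_sq_pos hx).ne']
      ring

/-- The solution of the Riccati equation attached to `v`. -/
def riccati (s : ℝ) (v v₁ : ℝ → ℝ) (x : ℝ) : ℝ :=
  (1 + s) * (1 - x) + (1 - x ^ 2) * (v₁ ((1 + x) / 2) / v ((1 + x) / 2))

lemma half_mem {x : ℝ} (hx : x ∈ Ioo (-1 : ℝ) 1) : (1 + x) / 2 ∈ Ico (0 : ℝ) 1 :=
  ⟨by linarith [hx.1], by linarith [hx.2]⟩

lemma hasDerivAt_comp_half {f : ℝ → ℝ} {f' x : ℝ} (h : HasDerivAt f f' ((1 + x) / 2)) :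
    HasDerivAt (fun x => f ((1 + x) / 2)) (f' * (1 / 2)) x :=
  h.comp x (((hasDerivAt_id x).const_add 1).div_const 2)

lemma isSolution_riccati {v v₁ v₂ : ℝ → ℝ} {s : ℝ} {c : ℝ × ℝ × ℝ} (hs : c.1 = s ^ 2 - 1)
    (h₁ : ∀ z ∈ Ico (0 : ℝ) 1, HasDerivAt v (v₁ z) z)
    (h₂ : ∀ z ∈ Ico (0 : ℝ) 1, HasDerivAt v₁ (v₂ z) z)
    (ode : ∀ z ∈ Ico (0 : ℝ) 1, z * v₂ z + (1 + s) * v₁ z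
      = ((c.1 + 2 * c.2.2) / 4 / (1 - z) + c.2.1 / 4 / (1 - z) ^ 2) * v z)
    (hv : ∀ z ∈ Ico (0 : ℝ) 1, 0 < v z) : IsSolution c (riccati s v v₁) := by
  refine isSolution_iff.2 fun x hx => ?_
  have hz := half_mem hx
  have hv0 := (hv _ hz).ne'
  have d1 := hasDerivAt_comp_half (h₁ _ hz)
  have d2 := hasDerivAt_comp_half (h₂ _ hz)
  have d3 : HasDerivAt (fun x : ℝ => (1 + s) * (1 - x)) ((1 + s) * -1) x := by
    simpa using ((hasDerivAt_id x).const_sub 1).const_mul (1 + s)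
  have d4 : HasDerivAt (fun x : ℝ => 1 - x ^ 2) (-(2 * x)) x := by
    simpa using ((hasDerivAt_pow 2 x).const_sub 1)
  refine (d3.add (d4.mul (d2.div d1 hv0))).congr_deriv ?_
  have o := ode _ hz
  have hx1 : 1 - x ≠ 0 := by linarith [hx.2]
  have hx2 : 1 + x ≠ 0 := by linarith [hx.1]
  rw [eq_div_iff (one_sub_sq_pos hx).ne']
  unfold riccati P
  simp only [Pi.div_apply]
  rw [show 1 - (1 + x) / 2 = (1 - x) / 2 by ring] at o
  generalize v₁ ((1 + x) / 2) = b at *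
  generalize v₂ ((1 + x) / 2) = d at *
  generalize v ((1 + x) / 2) = a at *
  field_simp at o ⊢
  rw [hs] at o ⊢
  linear_combination a * (1 + x) / 4 * o

/-- The Riccati solution attached to a positive solution of the linear equation that is regular at
`z = 0` dominates every other solution. -/
lemma le_riccati {v v₁ : ℝ → ℝ} {s : ℝ} {c : ℝ × ℝ × ℝ} (hs : 0 ≤ s)
    (h₁ : ∀ z ∈ Ico (0 : ℝ) 1, HasDerivAt v (v₁ z) z)
    (hv : ∀ z ∈ Ico (0 : ℝ) 1, 0 < v z) (hR : IsSolution c (riccati s v v₁))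
    {U : ℝ → ℝ} (hU : IsSolution c U) {x₀ : ℝ} (hx₀ : x₀ ∈ Ioo (-1 : ℝ) 1) :
    U x₀ ≤ riccati s v v₁ x₀ := by
  by_contra! hlt
  set R := riccati s v v₁ with hRdef
  have hU' := isSolution_iff.1 hU
  have hR' := isSolution_iff.1 hR
  have hUc : ContinuousOn U (Ioo (-1) 1) := fun x hx => (hU' x hx).continuousAt.continuousWithinAt
  have hRc : ContinuousOn R (Ioo (-1) 1) := fun x hx => (hR' x hx).continuousAt.continuousWithinAt
  set D : ℝ → ℝ := fun x => U x - R x with hDdef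
  have hDd : ∀ x ∈ Ioo (-1 : ℝ) 1,
      HasDerivAt D (-(2 * x + (U x + R x) / 2) / (1 - x ^ 2) * D x) x := fun x hx =>
    ((hU' x hx).sub (hR' x hx)).congr_deriv (by
      have := (one_sub_sq_pos hx).ne'
      simp only [hDdef]
      field_simp
      ring)
  have hDpos : ∀ x ∈ Ioo (-1 : ℝ) 1, 0 < D x := by
    refine pos_of_linear_ode ?_ hDd hx₀ (sub_pos.2 hlt)
    exact ContinuousOn.div (by fun_prop) (by fun_prop) fun x hx => (one_sub_sq_pos hx).ne'
  -- `D` satisfies a Bernoulli equation, hence `1 / D` a linear one; the factor `(1 - x) / v²`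
  -- removes its homogeneous part up to a term in `s ≥ 0`.
  set F : ℝ → ℝ := fun x => (1 - x) / (D x * v ((1 + x) / 2) ^ 2) with hFdef
  have hFpos : ∀ x ∈ Ioo (-1 : ℝ) 1, 0 < F x := fun x hx => by
    have h1 := hDpos x hx
    have h2 := hv _ (half_mem hx)
    have h3 : 0 < 1 - x := by linarith [hx.2]
    simp only [hFdef]
    positivity
  have hFd : ∀ x ∈ Ioo (-1 : ℝ) 1, HasDerivAt F
      ((s * (1 - x) + D x / 2) / (v ((1 + x) / 2) ^ 2 * D x * (1 + x))) x := by
    intro x hx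
    have hz := half_mem hx
    have hD0 := (hDpos x hx).ne'
    have hv0 := (hv _ hz).ne'
    have d1 := hasDerivAt_comp_half (h₁ _ hz)
    have d3 : HasDerivAt (fun x : ℝ => 1 - x) (-1) x := by
      simpa using (hasDerivAt_id x).const_sub 1
    refine (d3.div ((hDd x hx).mul (d1.pow 2)) (mul_ne_zero hD0 (pow_ne_zero 2 hv0))).congr_deriv ?_
    have hx1 : 1 - x ≠ 0 := by linarith [hx.2]
    have hx2 : 1 + x ≠ 0 := by linarith [hx.1]
    have e1 : U x = D x + R x := by simp [hDdef]
    have e2 : R x = (1 + s) * (1 - x) + (1 - x ^ 2) * (v₁ ((1 + x) / 2) / v ((1 + x) / 2)) := rfl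
    simp only [Pi.mul_apply, Pi.pow_apply]
    rw [e1, e2, show 1 - x ^ 2 = (1 - x) * (1 + x) by ring]
    generalize v₁ ((1 + x) / 2) = b at *
    generalize v ((1 + x) / 2) = a at *
    generalize D x = d at *
    field_simp
    ring
  have hvc : ContinuousOn v (Icc 0 ((1 + x₀) / 2)) := fun z hz =>
    (h₁ z ⟨hz.1, hz.2.trans_lt (half_mem hx₀).2⟩).continuousAt.continuousWithinAt
  obtain ⟨K, hK⟩ := isCompact_Icc.bddAbove_image (hvc.pow 2)
  have hKle : ∀ x ∈ Ioc (-1) x₀, v ((1 + x) / 2) ^ 2 ≤ K := fun x hx =>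
    hK (mem_image_of_mem _ ⟨by linarith [hx.1], by linarith [hx.2]⟩)
  have hKpos : 0 < K := (pow_pos (hv _ (half_mem hx₀)) 2).trans_le (hKle x₀ ⟨hx₀.1, le_rfl⟩)
  have hsub : ∀ x ∈ Ioc (-1) x₀, x ∈ Ioo (-1 : ℝ) 1 := fun x hx => ⟨hx.1, hx.2.trans_lt hx₀.2⟩
  have hHd : ∀ x ∈ Ioc (-1) x₀, HasDerivAt (fun x => F x - 1 / (2 * K) * Real.log (1 + x))
      ((s * (1 - x) + D x / 2) / (v ((1 + x) / 2) ^ 2 * D x * (1 + x))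
        - 1 / (2 * K) * (1 / (1 + x))) x := fun x hx => by
    have hx2 : 1 + x ≠ 0 := by linarith [hx.1]
    exact (hFd x (hsub x hx)).sub ((((hasDerivAt_id x).const_add 1).log hx2).const_mul _)
  -- Dropping the `s` term, `F' ≥ 1 / (2 v² (1 + x)) ≥ 1 / (2 K (1 + x))`, which is not integrable
  -- at `x = -1`.
  have hmono : MonotoneOn (fun x => F x - 1 / (2 * K) * Real.log (1 + x)) (Ioc (-1) x₀) := by
    refine monotoneOn_of_deriv_nonneg (convex_Ioc _ _)
      (fun x hx => (hHd x hx).continuousAt.continuousWithinAt)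
      (fun x hx => (hHd x (interior_subset hx)).differentiableAt.differentiableWithinAt)
      fun x hx => ?_
    have hx := interior_subset hx
    rw [(hHd x hx).deriv, sub_nonneg]
    have hx2 : 0 < 1 + x := by linarith [hx.1]
    have hx3 : 0 < 1 - x := by linarith [(hsub x hx).2]
    have hd := hDpos x (hsub x hx)
    have hv' := hv _ (half_mem (hsub x hx))
    have hk := hKle x hx
    calc 1 / (2 * K) * (1 / (1 + x)) ≤ 1 / (2 * v ((1 + x) / 2) ^ 2) * (1 / (1 + x)) := by gcongr
      _ = (D x / 2) / (v ((1 + x) / 2) ^ 2 * D x * (1 + x)) := by field_simp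
      _ ≤ _ := by
        gcongr
        nlinarith
  -- This threshold is chosen so that monotonicity yields `F (-1 + ε) < 0`.
  have hlog := Real.tendsto_log_nhdsGT_zero.eventually
    (Filter.eventually_lt_atBot (Real.log (1 + x₀) - 2 * K * F x₀))
  obtain ⟨ε, hε1, hε2, hε3⟩ := (hlog.and (Ioo_mem_nhdsGT (by linarith [hx₀.1] : 0 < 1 + x₀))).exists
  have hmem : -1 + ε ∈ Ioc (-1) x₀ := ⟨by linarith, by linarith⟩
  have h1 := hmono hmem ⟨hx₀.1, le_rfl⟩ hmem.2
  have h2 := hFpos _ (hsub _ hmem)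
  simp only [add_neg_cancel_left] at h1
  have h3 : 1 / (2 * K) * (Real.log (1 + x₀) - Real.log ε) > F x₀ := by
    rw [gt_iff_lt, one_div_mul_eq_div, lt_div_iff₀ (by positivity)]
    linarith
  linarith
-- The greatest solution and smoothness of `γ⁺`
/-- The parameters `(s, A, B)` of the linear equation attached to `c`. -/
def param (c : ℝ × ℝ × ℝ) : ℝ × ℝ × ℝ := (√(1 + c.1), (c.1 + 2 * c.2.2) / 4, c.2.1 / 4)

lemma exists_isGreatest {M : ℕ} {c : ℝ × ℝ × ℝ} (hc : c ∈ J)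
    (hM : |(param c).2.1| + |(param c).2.2| < M + 1) :
    0 < frob M (param c) (1 / 2) ∧
    IsSolution c (riccati (param c).1 (frob M (param c)) (frob' M (param c))) ∧
    ∀ U, IsSolution c U → ∀ x ∈ Ioo (-1 : ℝ) 1,
      U x ≤ riccati (param c).1 (frob M (param c)) (frob' M (param c)) x := by
  obtain ⟨hc1, hc2, hc3⟩ := hc
  have hs : 0 ≤ (param c).1 := Real.sqrt_nonneg _
  have hs2 : c.1 = (param c).1 ^ 2 - 1 := by
    rw [param, Real.sq_sqrt (by linarith)]
    ring
  have ht2 : √(1 + c.2.1) ^ 2 = 1 + c.2.1 := Real.sq_sqrt (by linarith)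
  have hu := isUnit_recOp hs hM
  have habs : ∀ z ∈ Ico (0 : ℝ) 1, |z| < 1 := fun z hz => by rw [abs_of_nonneg hz.1]; exact hz.2
  have h₁ : ∀ z ∈ Ico (0 : ℝ) 1, HasDerivAt (frob M (param c)) (frob' M (param c) z) z :=
    fun z hz => hasDerivAt_frob M _ (habs z hz)
  have h₂ : ∀ z ∈ Ico (0 : ℝ) 1, HasDerivAt (frob' M (param c)) (frob'' M (param c) z) z :=
    fun z hz => hasDerivAt_frob' M _ (habs z hz)
  have ode := fun z (hz : z ∈ Ico (0 : ℝ) 1) => frob_ode hu (habs z hz)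
  have hpos : ∀ z ∈ Ico (0 : ℝ) 1, 0 < frob M (param c) z := by
    -- This `β` is the larger root of `β (β - 1) = c₂ / 4`. With it, `A + B + β (1 + s) = (c₃ - c̄₃)
    -- / 2`, so the comparison condition is exactly `c₃ ≥ c̄₃`.
    refine pos_of_ode (β := (1 + √(1 + c.2.1)) / 2) hs h₁ h₂ ode (frob_zero hu) ?_ ?_
    · simp only [param]
      linear_combination ht2 / 4
    · unfold c3bar at hc3
      have hs' : √(1 + c.1) ^ 2 = 1 + c.1 := Real.sq_sqrt (by linarith)
      simp only [param]
      nlinarith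
  have hsol := isSolution_riccati hs2 h₁ h₂ ode hpos
  exact ⟨hpos _ ⟨by norm_num, by norm_num⟩, hsol, fun U hU x hx => le_riccati hs h₁ hpos hsol hU hx⟩

lemma Uplus_eq {c : ℝ × ℝ × ℝ} {V : ℝ → ℝ} (hV : IsSolution c V)
    (hmax : ∀ U, IsSolution c U → ∀ x ∈ Ioo (-1 : ℝ) 1, U x ≤ V x) {x : ℝ}
    (hx : x ∈ Ioo (-1 : ℝ) 1) : Uplus c x = V x := by
  refine IsGreatest.csSup_eq ⟨⟨V, hV, rfl⟩, ?_⟩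
  rintro y ⟨U, hU, rfl⟩
  exact hmax U hU x hx

lemma IsSolution.congr {c : ℝ × ℝ × ℝ} {U V : ℝ → ℝ} (hV : IsSolution c V)
    (h : ∀ x ∈ Ioo (-1 : ℝ) 1, U x = V x) : IsSolution c U := by
  refine isSolution_iff.2 fun x hx => ?_
  rw [h x hx]
  exact (isSolution_iff.1 hV x hx).congr_of_eventuallyEq
    (Filter.mem_of_superset (isOpen_Ioo.mem_nhds hx) h)

lemma Uplus_isGreatest {c : ℝ × ℝ × ℝ} (hc : c ∈ J) : IsSolution c (Uplus c) ∧
    ∀ U, IsSolution c U → ∀ x ∈ Ioo (-1 : ℝ) 1, U x ≤ Uplus c x := by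
  obtain ⟨M, hM⟩ := exists_nat_gt (|(param c).2.1| + |(param c).2.2|)
  obtain ⟨-, hV, hmax⟩ := exists_isGreatest hc (hM.trans (lt_add_one _))
  refine ⟨hV.congr fun x hx => Uplus_eq hV hmax hx, fun U hU x hx => ?_⟩
  rw [Uplus_eq hV hmax hx]
  exact hmax U hU x hx

/-- The value at `x = 0` of the greatest solution in terms of the parameters `(s, A, B)`. -/
def frobValue (M : ℕ) (p : ℝ × ℝ × ℝ) : ℝ := 1 + p.1 + frob' M p (1 / 2) / frob M p (1 / 2)

lemma gammaPlus_eq {M : ℕ} {c : ℝ × ℝ × ℝ} (hc : c ∈ J)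
    (hM : |(param c).2.1| + |(param c).2.2| < M + 1) :
    gammaPlus c = frobValue M (param c) := by
  obtain ⟨-, hV, hmax⟩ := exists_isGreatest hc hM
  rw [gammaPlus, Uplus_eq hV hmax ⟨by norm_num, by norm_num⟩, riccati, frobValue]
  norm_num

lemma contDiffAt_frobValue {M : ℕ} {c : ℝ × ℝ × ℝ} (hc : c ∈ J)
    (hM : |(param c).2.1| + |(param c).2.2| < M + 1) : ContDiffAt ℝ ∞ (frobValue M) (param c) := by
  have hu := isUnit_recOp (p := param c) (Real.sqrt_nonneg _) hM
  have hz : |(1 / 2 : ℝ)| < 1 := by rw [abs_of_pos] <;> norm_num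
  exact (contDiffAt_const.add contDiffAt_fst).add
    ((contDiffAt_frob' hu hz).div (contDiffAt_frob hu hz) (exists_isGreatest hc hM).1.ne')

/-- `M` has to exceed a bound depending on `c`, but the strict inequality persists nearby, so one
`M` serves locally. -/
lemma contDiffOn_gammaPlus_comp {X : Type*} [NormedAddCommGroup X] [NormedSpace ℝ X]
    {f : X → ℝ × ℝ × ℝ} {S : Set X} (hJ : ∀ x ∈ S, f x ∈ J)
    (hf : ContDiffOn ℝ ∞ (fun x => param (f x)) S) :
    ContDiffOn ℝ ∞ (fun x => gammaPlus (f x)) S := by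
  intro x hx
  obtain ⟨M, hM⟩ := exists_nat_gt (|(param (f x)).2.1| + |(param (f x)).2.2|)
  have hM' := hM.trans (lt_add_one _)
  have h := (contDiffAt_frobValue (hJ x hx) hM').comp_contDiffWithinAt x (hf x hx)
  have hcont : ContinuousWithinAt (fun y => |(param (f y)).2.1| + |(param (f y)).2.2|) S x := by
    have h := (hf x hx).continuousWithinAt.snd
    exact h.fst.abs.add h.snd.abs
  refine h.congr_of_eventuallyEq ?_ (gammaPlus_eq (hJ x hx) hM')
  filter_upwards [hcont.eventually (gt_mem_nhds hM'), self_mem_nhdsWithin] with y hy hyS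
  exact gammaPlus_eq (hJ y hyS) hy

/-! ### Reflection and `γ⁻` -/

/-- The parameters of the equation satisfied by `-U(-x)`. -/
def swap (c : ℝ × ℝ × ℝ) : ℝ × ℝ × ℝ := (c.2.1, c.1, c.2.2)

lemma swap_mem_J {c : ℝ × ℝ × ℝ} (hc : c ∈ J) : swap c ∈ J := by
  obtain ⟨h1, h2, h3⟩ := hc
  refine ⟨h2, h1, ?_⟩
  unfold c3bar at *
  simpa only [swap, add_comm (√(1 + c.2.1))] using h3

lemma IsSolution.reflect {c : ℝ × ℝ × ℝ} {U : ℝ → ℝ} (h : IsSolution c U) :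
    IsSolution (swap c) fun x => -U (-x) := by
  refine isSolution_iff.2 fun x hx => ?_
  have h1 := isSolution_iff.1 h (-x) ⟨by linarith [hx.2], by linarith [hx.1]⟩
  refine ((h1.comp x (hasDerivAt_neg x)).neg).congr_deriv ?_
  simp only [P, swap]
  ring

/-- No condition `c ∈ J` is needed: on `ℝ`, `sInf` is by definition `-sSup` of the negated set, and
reflection matches the two sets of values. -/
lemma Uminus_eq (c : ℝ × ℝ × ℝ) (x : ℝ) : Uminus c x = -Uplus (swap c) (-x) := by
  rw [Uminus, Real.sInf_def, Uplus]
  congr 2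
  ext y
  constructor
  · rintro ⟨U, hU, hy⟩
    exact ⟨_, hU.reflect, by simp [hy]⟩
  · rintro ⟨U, hU, rfl⟩
    exact ⟨_, hU.reflect, rfl⟩

lemma Uminus_isLeast {c : ℝ × ℝ × ℝ} (hc : c ∈ J) : IsSolution c (Uminus c) ∧
    ∀ U, IsSolution c U → ∀ x ∈ Ioo (-1 : ℝ) 1, Uminus c x ≤ U x := by
  obtain ⟨h1, h2⟩ := Uplus_isGreatest (swap_mem_J hc)
  refine ⟨IsSolution.congr h1.reflect fun x _ => Uminus_eq c x, fun U hU x hx => ?_⟩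
  have := h2 _ hU.reflect (-x) ⟨by linarith [hx.2], by linarith [hx.1]⟩
  rw [neg_neg] at this
  rw [Uminus_eq]
  linarith

lemma gammaMinus_eq (c : ℝ × ℝ × ℝ) : gammaMinus c = -gammaPlus (swap c) := by
  rw [gammaMinus, Uminus_eq, neg_zero, gammaPlus]

lemma contDiffOn_param {X : Type*} [NormedAddCommGroup X] [NormedSpace ℝ X]
    {f : X → ℝ × ℝ × ℝ} {S : Set X} (hf : ContDiff ℝ ∞ f)
    (hsqrt : ContDiffOn ℝ ∞ (fun x => √(1 + (f x).1)) S) :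
    ContDiffOn ℝ ∞ (fun x => param (f x)) S := by
  refine hsqrt.prodMk (ContDiff.contDiffOn ?_)
  fun_prop

end HomogNS
end

theorem theorem1p4 :
    -- on `J` the functions `U⁺(c)`, `U⁻(c)` are the greatest and the least solution
    (∀ c ∈ HomogNS.J,
      HomogNS.IsSolution c (HomogNS.Uplus c) ∧
      HomogNS.IsSolution c (HomogNS.Uminus c) ∧
      ∀ U : ℝ → ℝ, HomogNS.IsSolution c U → ∀ x ∈ Set.Ioo (-1 : ℝ) 1,
        HomogNS.Uminus c x ≤ U x ∧ U x ≤ HomogNS.Uplus c x) ∧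
    -- smoothness of `γ⁺`
    ContDiffOn ℝ ∞ HomogNS.gammaPlus (HomogNS.J \ {c | c.1 = -1}) ∧
    ContDiffOn ℝ ∞ (fun q : ℝ × ℝ => HomogNS.gammaPlus (-1, q.1, q.2))
      {q : ℝ × ℝ | (-1, q.1, q.2) ∈ HomogNS.J} ∧
    -- smoothness of `γ⁻`
    ContDiffOn ℝ ∞ HomogNS.gammaMinus (HomogNS.J \ {c | c.2.1 = -1}) ∧
    ContDiffOn ℝ ∞ (fun q : ℝ × ℝ => HomogNS.gammaMinus (q.1, -1, q.2))
      {q : ℝ × ℝ | (q.1, -1, q.2) ∈ HomogNS.J} := by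
  refine ⟨fun c hc => ⟨(HomogNS.Uplus_isGreatest hc).1, (HomogNS.Uminus_isLeast hc).1,
    fun U hU x hx => ⟨(HomogNS.Uminus_isLeast hc).2 U hU x hx,
      (HomogNS.Uplus_isGreatest hc).2 U hU x hx⟩⟩, ?_, ?_, ?_, ?_⟩
  · refine HomogNS.contDiffOn_gammaPlus_comp (f := id) (fun c hc => hc.1)
      (HomogNS.contDiffOn_param contDiff_id fun c hc => ContDiffAt.contDiffWithinAt ?_)
    refine ContDiffAt.sqrt (by fun_prop) fun h0 => hc.2 ?_
    exact eq_neg_of_add_eq_zero_right h0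
  · refine HomogNS.contDiffOn_gammaPlus_comp (f := fun q : ℝ × ℝ => (-1, q.1, q.2)) (fun q hq => hq)
      -- On this face `s` is constant, so the singularity of the square root at `0` plays no role.
      (HomogNS.contDiffOn_param (by fun_prop) (contDiffOn_const (c := √(1 + (-1 : ℝ)))))
  · simp only [funext HomogNS.gammaMinus_eq]
    refine (HomogNS.contDiffOn_gammaPlus_comp (f := HomogNS.swap)
      (fun c hc => HomogNS.swap_mem_J hc.1) (HomogNS.contDiffOn_param ?_
        fun c hc => ContDiffAt.contDiffWithinAt ?_)).neg
    · unfold HomogNS.swap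
      fun_prop
    · refine ContDiffAt.sqrt (f := fun c : ℝ × ℝ × ℝ => 1 + c.2.1) (by fun_prop) fun h0 => hc.2 ?_
      exact eq_neg_of_add_eq_zero_right h0
  · simp only [HomogNS.gammaMinus_eq]
    exact (HomogNS.contDiffOn_gammaPlus_comp
      (f := fun q : ℝ × ℝ => HomogNS.swap (q.1, -1, q.2)) (fun q hq => HomogNS.swap_mem_J hq)
      (HomogNS.contDiffOn_param (by unfold HomogNS.swap; fun_prop)
        (contDiffOn_const (c := √(1 + (-1 : ℝ)))))).neg
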